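/- Let $K$ be a non-Archimedean ordered field that is maximal ordered (that is, real closed: every positive element is a square and every polynomial of odd degree over $K$ has a root in $K$) and Cauchy complete, and suppose that $0$ has a countable basis of neighbourhoods in the order topology of $K$. Let $a\le b$ be elements of $K$ and let $S(X)=\sum_{n=0}^{\infty}a_nX^n$ be a power series over $K$, not identically zero (i.e. not all $a_n$ are $0$), that converges in the order topology at every point of the closed interval $[a,b]=\{x\in K: a\le x\le b\}$. Then $S$ has only finitely many zeros in $[a,b]$, i.e. the set $\{x\in[a,b] : \sum_{n=0}^{\infty}a_nx^n=0\}$ is finite. -/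

import Mathlib

open Filter Topology

namespace OrderedPowerSeries

variable {K : Type*} [Field K] [TopologicalSpace K]

/-- The value at `x` of the `n`-th partial sum `S_n(X) = ∑_{i=0}^n a_i X^i` of a power series. -/
noncomputable def partialSum (S : PowerSeries K) (n : ℕ) (x : K) : K :=
  ∑ i ∈ Finset.range (n + 1), PowerSeries.coeff i S * x ^ i

/-- The series `S` converges at `x` with sum `y`: the partial sums at `x` tend to `y`. -/
def ConvergesTo (S : PowerSeries K) (x y : K) : Prop :=
  Tendsto (fun n : ℕ => partialSum S n x) atTop (𝓝 y)

/-- The domain of `S`: the set of all points of `K` at which `S` converges. -/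
def domain (S : PowerSeries K) : Set K :=
  {x | ∃ y : K, ConvergesTo S x y}

/-- The zeros of `S`: the points at which `S` converges with sum `0`. -/
def zeroSet (S : PowerSeries K) : Set K :=
  {x | ConvergesTo S x 0}

end OrderedPowerSeries

/-!
The argument is Strassmann's theorem for the natural valuation `ArchimedeanClass.mk` of the ordered
field `K`, whose valuation ring is the ring of finite elements.

Let `e` be the endpoint of larger absolute value. If `e = 0` the interval is a point. Otherwise put
`a n = coeff n S * e ^ n`; convergence of `S` at `e` gives `a n → 0`, and every zero of `S` in the
interval is `y * e` with `|y| ≤ 1` and `∑ a n * y ^ n = 0`. Since `K` is not Archimedean,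
`a n` is eventually infinitely smaller than any fixed nonzero element (`eventually_mk_lt_mk`), so
among the `n` with `a n` not infinitely smaller than a fixed nonzero coefficient there is a last
one, `N`, and every later `a n` is infinitely smaller than `a N`.

Then there are at most `N` zeros (`card_le_of_tendsto_zero`). For if `s` is a set of `N + 1` finite
zeros, the divided difference over `s` is a fixed linear combination of the values at the points of
`s`, so it sends the partial sums of the series to a sequence that tends to `0`. On the other hand
the divided difference of `X ^ n` over `s` is `0` for `n < N`, is `1` for `n = N`, and is finite for
every `n`, being the top coefficient of the remainder of `X ^ n` modulo the monic polynomial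
`∏ x ∈ s, (X - x)` with finite coefficients. So the divided difference of a long partial sum is
`a N` plus terms of strictly smaller order, hence of the same Archimedean class as `a N ≠ 0`, and it
cannot tend to `0`.
-/

namespace OrderedPowerSeries

open Polynomial

section Algebra

variable {K : Type*} [Field K]

/-- The divided difference of `X ^ n` over the finite set `s`. -/
noncomputable def dividedDifferencePow [DecidableEq K] (s : Finset K) (n : ℕ) : K :=
  ∑ x ∈ s, x ^ n / ∏ y ∈ s.erase x, (x - y)

theorem dividedDifferencePow_eq_coeff [DecidableEq K] {s : Finset K} {N : ℕ} (hs : s.card = N + 1)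
    (n : ℕ) : dividedDifferencePow s n = (X ^ n %ₘ Lagrange.nodal s id : K[X]).coeff N := by
  have hdeg : (X ^ n %ₘ Lagrange.nodal s id : K[X]).degree < s.card := by
    rw [← Lagrange.degree_nodal (s := s) (v := (id : K → K))]
    exact degree_modByMonic_lt _ Lagrange.nodal_monic
  have h := Lagrange.coeff_eq_sum (s := s) (v := (id : K → K)) Function.injective_id.injOn hdeg
  rw [hs, Nat.add_sub_cancel] at h
  rw [h, dividedDifferencePow]
  refine Finset.sum_congr rfl fun x hx => ?_
  have hx0 : (Lagrange.nodal s (id : K → K)).IsRoot x :=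
    Lagrange.eval_nodal_at_node (v := (id : K → K)) hx
  have he : (X ^ n %ₘ Lagrange.nodal s id : K[X]).eval x = x ^ n := by
    have := congrArg (eval x) (modByMonic_add_div (X ^ n : K[X]) (Lagrange.nodal s (id : K → K)))
    rw [eval_add, eval_mul, hx0.eq_zero, zero_mul, add_zero, eval_pow, eval_X] at this
    exact this
  simp only [id_eq, he]

theorem dividedDifferencePow_of_lt [DecidableEq K] {s : Finset K} {N n : ℕ} (hs : s.card = N + 1)
    (hn : n < N) : dividedDifferencePow s n = 0 := by
  rw [dividedDifferencePow_eq_coeff hs, (modByMonic_eq_self_iff Lagrange.nodal_monic).2,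
    coeff_X_pow, if_neg hn.ne']
  rw [Lagrange.degree_nodal, degree_X_pow, hs]
  exact_mod_cast hn.trans N.lt_succ_self

theorem dividedDifferencePow_self [DecidableEq K] {s : Finset K} {N : ℕ} (hs : s.card = N + 1) :
    dividedDifferencePow s N = 1 := by
  rw [dividedDifferencePow_eq_coeff hs, (modByMonic_eq_self_iff Lagrange.nodal_monic).2,
    coeff_X_pow, if_pos rfl]
  rw [Lagrange.degree_nodal, degree_X_pow, hs]
  exact_mod_cast N.lt_succ_self

/-- Division with remainder by a monic polynomial stays inside a subring, hence so do divided
differences of powers. -/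
theorem dividedDifferencePow_mem [DecidableEq K] (R : Subring K) {s : Finset K} {N : ℕ}
    (hs : s.card = N + 1) (hR : ∀ x ∈ s, x ∈ R) (n : ℕ) : dividedDifferencePow s n ∈ R := by
  have hnodal : (Lagrange.nodal s.attach fun x => (⟨x, hR x x.2⟩ : R)).map R.subtype =
      Lagrange.nodal s id := by
    rw [Lagrange.nodal, Lagrange.nodal, Polynomial.map_prod, ← Finset.prod_attach s]
    simp
  rw [dividedDifferencePow_eq_coeff hs, ← hnodal, ← Polynomial.map_X R.subtype,
    ← Polynomial.map_pow, ← map_modByMonic _ Lagrange.nodal_monic, coeff_map]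
  exact Subtype.property _

end Algebra

variable {K : Type*} [Field K] [LinearOrder K] [IsStrictOrderedRing K]

/-- The subring of finite elements of `K`: those bounded in absolute value by a natural number. -/
def finiteSubring (K : Type*) [Field K] [LinearOrder K] [IsStrictOrderedRing K] : Subring K where
  carrier := {x | 0 ≤ ArchimedeanClass.mk x}
  mul_mem' {x y} hx hy := by
    simpa using add_nonneg hx hy
  one_mem' := by simp
  add_mem' {x y} hx hy :=
    show 0 ≤ ArchimedeanClass.mk (x + y) from
      (le_min hx hy).trans (ArchimedeanClass.min_le_mk_add x y)
  zero_mem' := by simp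
  neg_mem' {x} hx := by simpa using hx

variable [TopologicalSpace K] [OrderTopology K]

/-- In a non-Archimedean field the elements infinitely smaller than a given nonzero element form a
neighbourhood of `0`. -/
theorem eventually_mk_lt_mk (hna : ¬ Archimedean K) {c : K} (hc : c ≠ 0) :
    ∀ᶠ x in 𝓝 (0 : K), ArchimedeanClass.mk c < ArchimedeanClass.mk x := by
  obtain ⟨d, hd0, hd⟩ : ∃ d : K, d ≠ 0 ∧ 0 < ArchimedeanClass.mk d := by
    by_contra! h
    refine hna (ArchimedeanClass.archimedean_of_mk_eq_mk fun x hx y hy => ?_)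
    have key : ∀ z : K, z ≠ 0 → ArchimedeanClass.mk z = 0 := fun z hz => by
      refine le_antisymm (h z hz) ?_
      calc (0 : ArchimedeanClass K) = ArchimedeanClass.mk z + ArchimedeanClass.mk z⁻¹ := by
            rw [← ArchimedeanClass.mk_mul, mul_inv_cancel₀ hz, ArchimedeanClass.mk_one]
        _ ≤ ArchimedeanClass.mk z + 0 := add_le_add_right (h z⁻¹ (inv_ne_zero hz)) _
        _ = ArchimedeanClass.mk z := add_zero _
    rw [key x hx, key y hy]
  have hpos : 0 < |c * d| := abs_pos.2 (mul_ne_zero hc hd0)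
  filter_upwards [Ioo_mem_nhds (neg_lt_zero.2 hpos) hpos] with x hx
  have h1 : ArchimedeanClass.mk (c * d) ≤ ArchimedeanClass.mk x :=
    ArchimedeanClass.mk_le_mk_of_abs (abs_lt.2 hx).le
  refine lt_of_lt_of_le ?_ h1
  rw [ArchimedeanClass.mk_mul]
  have := (ArchimedeanClass.isAddRegular_mk hc).left
  refine lt_of_le_of_ne (le_add_of_nonneg_right hd.le) fun h => hd.ne (this ?_)
  simpa using h

/-- Strassmann's bound: if every coefficient after the `N`-th is infinitely smaller than the `N`-th,
then the series has at most `N` finite zeros. -/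
theorem card_le_of_tendsto_zero (hna : ¬ Archimedean K) {a : ℕ → K} {N : ℕ}
    (haN : ∀ n, N < n → ArchimedeanClass.mk (a N) < ArchimedeanClass.mk (a n))
    {s : Finset K} (hfin : ∀ x ∈ s, 0 ≤ ArchimedeanClass.mk x)
    (hzero : ∀ x ∈ s, Tendsto (fun n => ∑ i ∈ Finset.range (n + 1), a i * x ^ i) atTop (𝓝 0)) :
    s.card ≤ N := by
  classical
  by_contra! hcard
  obtain ⟨t, hts, ht⟩ := Finset.exists_subset_card_eq (Nat.succ_le_of_lt hcard)
  have haN_lt_top : ArchimedeanClass.mk (a N) < ⊤ := (haN _ N.lt_succ_self).trans_le le_top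
  have haN0 : a N ≠ 0 := fun h => haN_lt_top.ne (ArchimedeanClass.mk_eq_top_iff.2 h)
  have hlim : Tendsto
      (fun n => ∑ i ∈ Finset.range (n + 1), a i * dividedDifferencePow t i) atTop (𝓝 0) := by
    have h : Tendsto (fun n => ∑ x ∈ t, (∑ i ∈ Finset.range (n + 1), a i * x ^ i) *
        (∏ y ∈ t.erase x, (x - y))⁻¹) atTop (𝓝 (∑ x ∈ t, 0 * (∏ y ∈ t.erase x, (x - y))⁻¹)) :=
      tendsto_finsetSum _ fun x hx => (hzero x (hts hx)).mul_const _
    simp only [zero_mul, Finset.sum_const_zero] at h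
    refine h.congr fun n => ?_
    simp only [dividedDifferencePow, Finset.mul_sum, Finset.sum_mul]
    rw [Finset.sum_comm]
    refine Finset.sum_congr rfl fun i _ => Finset.sum_congr rfl fun x _ => ?_
    rw [div_eq_mul_inv, mul_assoc]
  obtain ⟨n, hn, hNn⟩ :=
    ((hlim.eventually (eventually_mk_lt_mk hna haN0)).and (eventually_ge_atTop N)).exists
  have hrest : ArchimedeanClass.mk (a N) < ArchimedeanClass.mk
      (∑ i ∈ (Finset.range (n + 1)).erase N, a i * dividedDifferencePow t i) := by
    simp only [← ArchimedeanClass.addValuation_apply]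
    refine (ArchimedeanClass.addValuation K).map_lt_sum' haN_lt_top fun i hi => ?_
    simp only [ArchimedeanClass.addValuation_apply]
    rcases lt_or_gt_of_ne (Finset.ne_of_mem_erase hi) with hlt | hgt
    · rw [dividedDifferencePow_of_lt ht hlt, mul_zero, ArchimedeanClass.mk_zero]
      exact haN_lt_top
    · have hd : 0 ≤ ArchimedeanClass.mk (dividedDifferencePow t i) :=
        dividedDifferencePow_mem (finiteSubring K) ht (fun x hx => (hfin x (hts hx) :)) i
      rw [ArchimedeanClass.mk_mul]
      exact (haN i hgt).trans_le (le_add_of_nonneg_right hd)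
  rw [← Finset.add_sum_erase _ _ (Finset.mem_range.2 (Nat.lt_succ_of_le hNn)),
    dividedDifferencePow_self ht, mul_one, ArchimedeanClass.mk_add_eq_mk_left hrest] at hn
  exact hn.false

/-- The index found is the last `N` with `a N` not infinitely smaller than `a m`. -/
theorem exists_forall_gt_mk_lt_mk (hna : ¬ Archimedean K) {a : ℕ → K}
    (ha : Tendsto a atTop (𝓝 0)) {m : ℕ} (hm : a m ≠ 0) :
    ∃ N, ∀ n, N < n → ArchimedeanClass.mk (a N) < ArchimedeanClass.mk (a n) := by
  obtain ⟨B, hB⟩ := eventually_atTop.1 (ha.eventually (eventually_mk_lt_mk hna hm))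
  have hfin : {n | ArchimedeanClass.mk (a n) ≤ ArchimedeanClass.mk (a m)}.Finite :=
    (Set.finite_lt_nat B).subset fun n hn => by
      by_contra h
      exact ((hB n (not_lt.1 h)).trans_le hn).false
  obtain ⟨N, hN⟩ := hfin.exists_maximal ⟨m, le_refl (ArchimedeanClass.mk (a m))⟩
  have hNm : ArchimedeanClass.mk (a N) ≤ ArchimedeanClass.mk (a m) := hN.prop
  exact ⟨N, fun n hn => lt_of_not_ge fun h => hn.not_ge (hN.le_of_ge (h.trans hNm) hn.le)⟩

theorem finite_zeroSet_of_mem_domain (hna : ¬ Archimedean K)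
    {S : PowerSeries K} (hS : S ≠ 0) {e : K} (he : e ≠ 0) (hdom : e ∈ domain S) :
    ({x | |x| ≤ |e|} ∩ zeroSet S).Finite := by
  classical
  obtain ⟨y, hy⟩ := hdom
  obtain ⟨m, hm⟩ : ∃ m, PowerSeries.coeff m S ≠ 0 := by
    by_contra! h
    exact hS (PowerSeries.ext h)
  have hterm : Tendsto (fun n => PowerSeries.coeff n S * e ^ n) atTop (𝓝 0) := by
    rw [← tendsto_add_atTop_iff_nat 1]
    have h := ((tendsto_add_atTop_iff_nat 1).2 hy).sub hy
    rw [sub_self] at h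
    refine h.congr fun n => ?_
    rw [partialSum, partialSum, Finset.sum_range_succ _ (n + 1), add_sub_cancel_left]
  obtain ⟨N, hN⟩ := exists_forall_gt_mk_lt_mk hna hterm (mul_ne_zero hm (pow_ne_zero m he))
  by_contra hinf
  obtain ⟨s, hs, hcard⟩ := Set.Infinite.exists_subset_card_eq hinf (N + 1)
  have hle : (s.image (· / e)).card ≤ N := by
    refine card_le_of_tendsto_zero hna hN ?_ ?_ <;>
      simp only [Finset.mem_image, forall_exists_index, and_imp, forall_apply_eq_imp_iff₂]
    · intro x hx
      rw [← ArchimedeanClass.mk_one]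
      refine ArchimedeanClass.mk_le_mk_of_abs ?_
      rw [abs_div, abs_one]
      exact div_le_one_of_le₀ (hs hx).1 (abs_nonneg e)
    · intro x hx
      refine (show Tendsto _ _ _ from (hs hx).2).congr fun n => ?_
      refine Finset.sum_congr rfl fun i _ => ?_
      rw [div_pow, mul_assoc, mul_div_cancel₀ _ (pow_ne_zero i he)]
  rw [Finset.card_image_of_injective _ fun x y h => (div_left_inj' he).1 h, hcard] at hle
  exact N.not_succ_le_self hle

end OrderedPowerSeries

theorem corollary5p4 {K : Type*} [Field K] [LinearOrder K] [IsStrictOrderedRing K]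
    [UniformSpace K] [IsUniformAddGroup K] [OrderTopology K]
    [CompleteSpace K] [IsRealClosed K] [(𝓝 (0 : K)).IsCountablyGenerated]
    (hna : ¬ Archimedean K)
    (S : PowerSeries K) (hS : S ≠ 0) (a b : K) (hab : a ≤ b)
    (hdom : Set.Icc a b ⊆ OrderedPowerSeries.domain S) :
    (Set.Icc a b ∩ OrderedPowerSeries.zeroSet S).Finite := by
  obtain ⟨e, he, hmax⟩ : ∃ e ∈ Set.Icc a b, ∀ x ∈ Set.Icc a b, |x| ≤ |e| := by
    rcases le_total |a| |b| with h | h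
    · exact ⟨b, ⟨hab, le_rfl⟩, fun x hx => (abs_le_max_abs_abs hx.1 hx.2).trans_eq (max_eq_right h)⟩
    · exact ⟨a, ⟨le_rfl, hab⟩, fun x hx => (abs_le_max_abs_abs hx.1 hx.2).trans_eq (max_eq_left h)⟩
  rcases eq_or_ne e 0 with rfl | he0
  · refine (Set.finite_singleton (0 : K)).subset fun x hx => ?_
    simpa using hmax x hx.1
  · exact (OrderedPowerSeries.finite_zeroSet_of_mem_domain hna hS he0 (hdom he)).subset
      (Set.inter_subset_inter_left _ hmax)
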